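/- Let $p>3$ be a prime and let $n>1$ be an integer with $\gcd(n,p)=\gcd(n,p^2-1)=1$ (so that the Chebyshev polynomial of the first kind $T_n$, defined by $T_0=1$, $T_1=x$, $T_n=2xT_{n-1}-T_{n-2}$, permutes $\mathbb{Z}_{p^k}=\mathbb{Z}/p^k\mathbb{Z}$ for every $k\ge 1$). Let $F_{p^k}$ be the functional graph of $T_n$ over $\mathbb{Z}_{p^k}$: its vertices are the elements of $\mathbb{Z}_{p^k}$, with an arc from $x$ to $y$ if and only if $y=T_n(x)$. Let $N_{T_c,k}$ be the number of directed cycles of length $T_c\ge 1$ in $F_{p^k}$. Let $\mathrm{ord}(n^2)$ be the multiplicative order of $n^2$ modulo $p$. Then the maximum in $$k_s=\max\{t : n^{2\cdot \mathrm{ord}(n^2)}\equiv 1 \pmod{p^t}\}+1$$ exists, and the following hold. 1. For every cycle length $T_c$ that occurs in $F_{p^{k_s}}$ (that is, $N_{T_c,k_s}\neq 0$), $N_{T_c,k}=N_{T_c,k_s}$ for all $k>k_s$. 2. For every cycle length $T_c$ that occurs in $F_{p^{k_0}}$ for some $k_0>k_s$, $N_{T_c,k}=N_{T_c,k_0}$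 for all $k>k_0$. Thus, beyond $k_s$, the number of cycles of a given length never changes once that length has occurred. 3. For every $T_c\ge 1$, whether or not it occurs, if $p^i$ is the exact power of $p$ dividing $T_c$, then $N_{T_c,k}=N_{T_c,k_s+i}$ for all $k>k_s+i$. In particular, if $p\nmid T_c$, then $N_{T_c,k}=N_{T_c,k_s}$ for all $k>k_s$. -/

import Mathlib

/-- The functional graph of a map `f : V → V`: the vertices are the elements of `V`, and there is
an arc from `x` to `y` if and only if `y = f x`. -/
def functionalGraph {V : Type*} (f : V → V) : Digraph V where
  Adj x y := y = f x

/-- A directed cycle of a digraph: a nonempty cyclic list of pairwise distinct vertices, each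
joined by an arc to the next one, and the last one to the first one (so a one-element
list is a directed cycle exactly when its vertex carries a self-loop). -/
def IsDirectedCycle {V : Type*} (G : Digraph V) (c : Cycle V) : Prop :=
  c ≠ Cycle.nil ∧ c.Nodup ∧ c.Chain G.Adj

/-- The number of directed cycles of length `L` in the digraph `G`. -/
noncomputable def numDirectedCycles {V : Type*} (G : Digraph V) (L : ℕ) : ℕ :=
  Set.ncard {c : Cycle V | IsDirectedCycle G c ∧ c.length = L}

/-- The map `x ↦ T_n(x)` on the residue ring modulo `p ^ k`, where `T_n` is the Chebyshev
polynomial of the first kind of degree `n`. -/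
noncomputable def chebyshevMap (n p k : ℕ) (x : ZMod (p ^ k)) : ZMod (p ^ k) :=
  (Polynomial.Chebyshev.T (ZMod (p ^ k)) (n : ℤ)).eval x

/-- The number `N_{L, k}` of cycles of length `L` in the functional graph of `T_n` over the
residue ring modulo `p ^ k`. -/
noncomputable def numChebyshevCycles (n p L k : ℕ) : ℕ :=
  numDirectedCycles (functionalGraph (chebyshevMap n p k)) L

/-! The number of cycles of length L is determined by the numbers of fixed points of the d-th
iterates, d ∣ L, and the d-th iterate of T_n is T_m with m = n^d. Fixed points of T_m modulo p^k are
counted in each residue class modulo p. A class fixed by T_m contains an integer a at which the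
linear Taylor term of T_m - X dominates (`exists_taylor_dominated`). If p^e exactly divides the
derivative at a, Hensel lifting gives p^e roots for every k > e (`card_roots_residue_class`).

Domination away from ±1 comes from α = x + √(x²-1), with α^m = T_m(x) + U_{m-1}(x)√(x²-1). Fixing x
modulo p means α^m ≡ α^ε with ε = ±1, and this improves to a congruence modulo p^(e+1) when p^e ∣ m
- ε. The classes of ±1 and the higher derivatives are handled by the Chebyshev differential
equation.

Here e ≤ v_p(n^(2d) - 1) ≤ w + v_p(d) by lifting the exponent, so the counts are constant for k > w
+ v_p(L), which is claim 3. Claims 1 and 2 follow because a length L occurring modulo p^(w+1+i) has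
v_p(L) ≤ i (`padicValNat_minimalPeriod_le`): if L₁ < p is the period modulo p, then L divides
2·ord(n²)·L₁·p^i. -/

/-! ### Cycles of a functional graph and fixed points of iterates -/

theorem isChain_functionalGraph_eq_map {V : Type*} (f : V → V) (l : List V) :
    ∀ x, List.IsChain (functionalGraph f).Adj (x :: l) →
      x :: l = (List.range (l.length + 1)).map (fun i => f^[i] x) := by
  induction l with
  | nil => intro x _; simp
  | cons y l ih =>
    intro x h
    rw [List.isChain_cons_cons] at h
    obtain ⟨hxy, h⟩ := h
    have hy : y = f x := hxy
    have := ih y h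
    rw [List.length_cons, List.range_succ_eq_map, List.map_cons, List.map_map, this, hy]
    simp [Function.comp_def]

theorem IsDirectedCycle.eq_periodicOrbit {V : Type*} {f : V → V} {c : Cycle V}
    (hc : IsDirectedCycle (functionalGraph f) c) {x : V} (hx : x ∈ c) :
    Function.minimalPeriod f x = c.length ∧ c = Function.periodicOrbit f x := by
  obtain ⟨-, hnd, hch⟩ := hc
  obtain ⟨l, rfl⟩ : ∃ l : List V, c = ((x :: l : List V) : Cycle V) := by
    induction c using Quotient.inductionOn with
    | _ l =>
      have hx' : x ∈ l := hx
      obtain ⟨s, t, rfl⟩ := List.append_of_mem hx'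
      refine ⟨t ++ s, ?_⟩
      have : ((s ++ x :: t : List V) : Cycle V) = ((x :: t ++ s : List V) : Cycle V) :=
        Cycle.coe_eq_coe.2 ⟨s.length, by simp⟩
      exact this
  rw [Cycle.chain_coe_cons] at hch
  have h := isChain_functionalGraph_eq_map f _ x hch
  have h1 : x :: l ++ [x] = (List.range (l.length + 1)).map (fun i => f^[i] x)
      ++ [f^[l.length + 1] x] := by
    rw [List.cons_append, h, List.length_append, List.length_singleton, List.range_succ,
      List.map_append]
    rfl
  obtain ⟨h2, h3⟩ := List.append_inj' h1 rfl
  have h4 : f^[l.length + 1] x = x := (List.singleton_injective h3).symm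
  have hnd' : (x :: l).Nodup := hnd
  have hper : Function.minimalPeriod f x = l.length + 1 := by
    have hp : Function.IsPeriodicPt f (l.length + 1) x := h4
    refine le_antisymm (hp.minimalPeriod_le (Nat.succ_pos _)) ?_
    by_contra! hlt
    have hpos := hp.minimalPeriod_pos (Nat.succ_pos _)
    rw [h2, List.nodup_map_iff_inj_on List.nodup_range] at hnd'
    have := hnd' _ (List.mem_range.2 hlt) 0 (List.mem_range.2 (Nat.succ_pos _))
      (by simp)
    omega
  refine ⟨by simp [hper], ?_⟩
  rw [Function.periodicOrbit_def, hper, ← h2]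

theorem isDirectedCycle_periodicOrbit {V : Type*} {f : V → V} {x : V}
    (hx : x ∈ Function.periodicPts f) :
    IsDirectedCycle (functionalGraph f) (Function.periodicOrbit f x) := by
  refine ⟨?_, Function.nodup_periodicOrbit, ?_⟩
  · rw [Ne, Function.periodicOrbit_eq_nil_iff_not_periodic_pt]
    exact fun h => h hx
  · rw [Function.periodicOrbit_chain' _ hx]
    intro n
    exact Function.iterate_succ_apply' f n x

-- Cycles of length L are the periodic orbits of points of minimal period L, and each orbit is hit
-- by exactly L such points.
open Classical in
theorem mul_numDirectedCycles {V : Type*} [Fintype V] (f : V → V) {L : ℕ} (hL : 0 < L) :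
    L * numDirectedCycles (functionalGraph f) L =
      (Finset.univ.filter fun x => Function.minimalPeriod f x = L).card := by
  set S := Finset.univ.filter fun x => Function.minimalPeriod f x = L with hS
  have hper : ∀ x ∈ S, x ∈ Function.periodicPts f := fun x hx => by
    rw [← Function.minimalPeriod_pos_iff_mem_periodicPts, (Finset.mem_filter.1 hx).2]
    exact hL
  have hset : {c : Cycle V | IsDirectedCycle (functionalGraph f) c ∧ c.length = L} =
      ((S.image (Function.periodicOrbit f) : Finset (Cycle V)) : Set (Cycle V)) := by
    ext c
    simp only [Set.mem_ofPred_eq, Finset.coe_image, Set.mem_image, Finset.mem_coe]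
    constructor
    · rintro ⟨hc, hl⟩
      obtain ⟨x, hx⟩ : ∃ x, x ∈ c := by
        by_contra! h
        refine hc.1 ?_
        induction c using Cycle.induction_on with
        | nil => rfl
        | cons a l _ => exact absurd (Cycle.mem_coe_iff.2 List.mem_cons_self) (h a)
      obtain ⟨h1, h2⟩ := hc.eq_periodicOrbit hx
      exact ⟨x, by simp [hS, h1, hl], h2.symm⟩
    · rintro ⟨x, hx, rfl⟩
      exact ⟨isDirectedCycle_periodicOrbit (hper x hx), by
        rw [Function.periodicOrbit_length]; exact (Finset.mem_filter.1 hx).2⟩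
  rw [numDirectedCycles, hset, Set.ncard_coe_finset, mul_comm]
  rw [Finset.card_eq_sum_card_image (Function.periodicOrbit f) S]
  symm
  refine Finset.sum_const_nat fun c hc => ?_
  obtain ⟨y, hy, rfl⟩ := Finset.mem_image.1 hc
  have hyL : Function.minimalPeriod f y = L := (Finset.mem_filter.1 hy).2
  have hfib : (S.filter fun x => Function.periodicOrbit f x = Function.periodicOrbit f y) =
      (Finset.range L).image fun i => f^[i] y := by
    ext x
    simp only [Finset.mem_filter, Finset.mem_image, Finset.mem_range]
    constructor
    · rintro ⟨hx, hxy⟩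
      have hmem : x ∈ Function.periodicOrbit f y :=
        hxy ▸ Function.self_mem_periodicOrbit (hper x hx)
      rw [Function.periodicOrbit_def, hyL] at hmem
      simpa [eq_comm] using hmem
    · rintro ⟨i, -, rfl⟩
      refine ⟨Finset.mem_filter.2 ⟨Finset.mem_univ _, ?_⟩,
        Function.periodicOrbit_apply_iterate_eq (hper y hy) i⟩
      rw [Function.minimalPeriod_apply_iterate (hper y hy), hyL]
  rw [hfib, Finset.card_image_of_injOn, Finset.card_range]
  intro i hi j hj hij
  rw [Finset.coe_range, ← hyL] at hi hj
  exact Function.iterate_injOn_Iio_minimalPeriod hi hj hij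

theorem card_isPeriodicPt_eq_sum {V : Type*} [Fintype V] [DecidableEq V] (f : V → V) {L : ℕ}
    (hL : 0 < L) : (Finset.univ.filter fun x => f^[L] x = x).card =
      ∑ d ∈ L.divisors, (Finset.univ.filter fun x => Function.minimalPeriod f x = d).card := by
  rw [Finset.card_eq_sum_card_fiberwise (f := Function.minimalPeriod f) (t := L.divisors)]
  · refine Finset.sum_congr rfl fun d hd => ?_
    congr 1
    ext x
    simp only [Finset.mem_filter, Finset.mem_univ, true_and, and_iff_right_iff_imp]
    rintro rfl
    exact Function.isPeriodicPt_iff_minimalPeriod_dvd.2 (Nat.dvd_of_mem_divisors hd)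
  · intro x hx
    have hx' : f^[L] x = x := by simpa using hx
    exact Nat.mem_divisors.2 ⟨Function.IsPeriodicPt.minimalPeriod_dvd hx', hL.ne'⟩

/-- Möbius inversion, carried out as strong induction over the proper divisors of L. -/
theorem card_minimalPeriod_eq_of_card_isPeriodicPt_eq {V W : Type*} [Fintype V] [Fintype W]
    [DecidableEq V] [DecidableEq W] (f : V → V) (g : W → W) (L : ℕ) (hL : 0 < L)
    (h : ∀ d, d ∣ L → (Finset.univ.filter fun x => f^[d] x = x).card =
      (Finset.univ.filter fun x => g^[d] x = x).card) :
    (Finset.univ.filter fun x => Function.minimalPeriod f x = L).card =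
      (Finset.univ.filter fun x => Function.minimalPeriod g x = L).card := by
  induction L using Nat.strong_induction_on with
  | _ L ih =>
    have hfg := h L dvd_rfl
    rw [card_isPeriodicPt_eq_sum f hL, card_isPeriodicPt_eq_sum g hL,
      ← Nat.cons_self_properDivisors hL.ne',
      Finset.sum_cons, Finset.sum_cons] at hfg
    rw [Finset.sum_congr rfl fun d hd => ?_] at hfg
    · exact Nat.add_right_cancel hfg
    · obtain ⟨h1, h2⟩ := Nat.mem_properDivisors.1 hd
      exact ih d h2 (Nat.pos_of_dvd_of_pos h1 hL) fun e he => h e (he.trans h1)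

theorem numDirectedCycles_eq_of_card_isPeriodicPt_eq {V W : Type*} [Fintype V] [Fintype W]
    [DecidableEq V] [DecidableEq W] (f : V → V) (g : W → W) {L : ℕ} (hL : 0 < L)
    (h : ∀ d, d ∣ L → (Finset.univ.filter fun x => f^[d] x = x).card =
      (Finset.univ.filter fun x => g^[d] x = x).card) :
    numDirectedCycles (functionalGraph f) L = numDirectedCycles (functionalGraph g) L := by
  refine Nat.eq_of_mul_eq_mul_left hL ?_
  rw [mul_numDirectedCycles f hL, mul_numDirectedCycles g hL]
  convert card_minimalPeriod_eq_of_card_isPeriodicPt_eq f g L hL h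

theorem exists_minimalPeriod_eq_of_numDirectedCycles_ne_zero {V : Type*} {f : V → V} {L : ℕ}
    (h : numDirectedCycles (functionalGraph f) L ≠ 0) : ∃ x, Function.minimalPeriod f x = L := by
  obtain ⟨c, hc, hl⟩ := Set.nonempty_of_ncard_ne_zero h
  obtain ⟨x, hx⟩ : ∃ x, x ∈ c := by
    by_contra! h
    refine hc.1 ?_
    induction c using Cycle.induction_on with
    | nil => rfl
    | cons a l _ => exact absurd (Cycle.mem_coe_iff.2 List.mem_cons_self) (h a)
  exact ⟨x, (hc.eq_periodicOrbit hx).1.trans hl⟩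
-- Roots modulo p^k when the linear Taylor term dominates
open Polynomial

/-- The remainder is kept as a polynomial P, so that s - t ∣ P(s) - P(t) is available when two
values are compared. -/
theorem Polynomial.exists_eval_add_mul_eq (g : ℤ[X]) (a q N : ℤ)
    (h : ∀ j, 2 ≤ j → N ∣ q ^ j * (hasseDeriv j g).eval a) :
    ∃ P : ℤ[X], ∀ s, g.eval (a + q * s) =
      g.eval a + g.derivative.eval a * (q * s) + N * P.eval s := by
  have hdvd : C N ∣ (taylor a g).comp (C q * X) - C (g.eval a) -
      C (g.derivative.eval a * q) * X := by
    rw [C_dvd_iff_dvd_coeff]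
    intro j
    simp only [coeff_sub, comp_C_mul_X_coeff, taylor_coeff, coeff_C_mul, coeff_C, coeff_X]
    match j with
    | 0 => simp
    | 1 => simp [hasseDeriv_one]
    | j + 2 => simpa [coeff_C, coeff_X, mul_comm] using h (j + 2) (by omega)
  obtain ⟨P, hP⟩ := hdvd
  refine ⟨P, fun s => ?_⟩
  have := congrArg (Polynomial.eval s) hP
  simp only [eval_sub, eval_comp, eval_mul, eval_C, eval_X, taylor_eval] at this
  rw [add_comm a]
  linear_combination this

section RootsInClass

variable {p : ℕ} {g : ℤ[X]} {a u : ℤ} {e : ℕ}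

theorem exists_eval_sub_eval_eq (h1 : g.derivative.eval a = p ^ e * u)
    (h2 : ∀ j, 2 ≤ j → (p : ℤ) ^ (e + 2) ∣ p ^ j * (hasseDeriv j g).eval a) (s t : ℤ) :
    ∃ v : ℤ, g.eval (a + p * s) - g.eval (a + p * t) = p ^ e * (p * (s - t)) * (u + p * v) := by
  obtain ⟨P, hP⟩ := g.exists_eval_add_mul_eq a p _ h2
  obtain ⟨v, hv⟩ := P.sub_dvd_eval_sub s t
  refine ⟨v, ?_⟩
  rw [hP, hP, h1]
  linear_combination (p : ℤ) ^ (e + 2) * hv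

theorem exists_root_of_dvd (hp : p.Prime) (h0 : (p : ℤ) ^ (e + 1) ∣ g.eval a)
    (h1 : g.derivative.eval a = p ^ e * u) (hu : ¬ (p : ℤ) ∣ u)
    (h2 : ∀ j, 2 ≤ j → (p : ℤ) ^ (e + 2) ∣ p ^ j * (hasseDeriv j g).eval a) (k : ℕ) :
    ∃ t : ℤ, (p : ℤ) ^ (e + 1 + k) ∣ g.eval (a + p * t) := by
  induction k with
  | zero => exact ⟨0, by simpa using h0⟩
  | succ k ih =>
    obtain ⟨t, c, hc⟩ := ih
    have hcop : IsCoprime (p : ℤ) u :=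
      ((Nat.prime_iff_prime_int.1 hp).coprime_iff_not_dvd).2 hu
    obtain ⟨x, y, hxy⟩ := hcop
    -- Newton step: y inverts u modulo p, and c is the current error divided by p^(e+1+k).
    obtain ⟨v, hv⟩ := exists_eval_sub_eval_eq h1 h2 (t + p ^ k * (-c * y)) t
    refine ⟨t + p ^ k * (-c * y), c * x - c * y * v, ?_⟩
    linear_combination hv + hc - (p : ℤ) ^ (e + 1 + k) * c * hxy

/-- On the class of a, g(a+ps) - g(a+pt) is p^(e+1)(s-t) times a number prime to p. Hence the roots
form one class modulo p^(k-e), which splits into p^e classes modulo p^k. -/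
theorem card_roots_residue_class (hp : p.Prime) (h0 : (p : ℤ) ^ (e + 1) ∣ g.eval a)
    (h1 : g.derivative.eval a = p ^ e * u) (hu : ¬ (p : ℤ) ∣ u)
    (h2 : ∀ j, 2 ≤ j → (p : ℤ) ^ (e + 2) ∣ p ^ j * (hasseDeriv j g).eval a) {k : ℕ}
    (hk : e + 1 ≤ k) [NeZero (p ^ k)] :
    (Finset.univ.filter fun x : ZMod (p ^ k) =>
      (g.map (Int.castRingHom (ZMod (p ^ k)))).eval x = 0 ∧
      ZMod.castHom (dvd_pow_self p (by omega : k ≠ 0)) (ZMod p) x = (a : ZMod p)).card = p ^ e := by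
  have hpZ := Nat.prime_iff_prime_int.1 hp
  have hp0 : (p : ℤ) ≠ 0 := hpZ.ne_zero
  obtain ⟨i, rfl⟩ := Nat.exists_eq_add_of_le hk
  obtain ⟨t, ht⟩ := exists_root_of_dvd hp h0 h1 hu h2 i
  set c : ℤ := a + p * t with hc
  have himg : (Finset.univ.filter fun x : ZMod (p ^ (e + 1 + i)) =>
      (g.map (Int.castRingHom (ZMod (p ^ (e + 1 + i))))).eval x = 0 ∧
      ZMod.castHom (dvd_pow_self p (by omega : e + 1 + i ≠ 0)) (ZMod p) x = (a : ZMod p)) =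
      (Finset.range (p ^ e)).image
        fun j : ℕ => ((c + p ^ (i + 1) * j : ℤ) : ZMod (p ^ (e + 1 + i))) := by
    ext x
    obtain ⟨x, rfl⟩ := ZMod.intCast_surjective x
    simp only [Finset.mem_filter, Finset.mem_univ, true_and, Finset.mem_image, Finset.mem_range,
      map_intCast, eval_intCast_map, eq_intCast, ZMod.intCast_zmod_eq_zero_iff_dvd]
    have key : ∀ s : ℤ, (p : ℤ) ^ (e + 1 + i) ∣ g.eval (a + p * s) ↔
        (p : ℤ) ^ (i + 1) ∣ a + p * s - c := by
      intro s
      obtain ⟨v, hv⟩ := exists_eval_sub_eval_eq h1 h2 s t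
      have hcop : IsCoprime ((p : ℤ) ^ (i + 1)) (u + p * v) := by
        refine IsCoprime.pow_left ((hpZ.coprime_iff_not_dvd).2 fun h => hu ?_)
        exact (Int.dvd_add_left (dvd_mul_right _ _)).1 h
      rw [← dvd_sub_left ht, hv, show e + 1 + i = e + (i + 1) by ring, pow_add, mul_assoc,
        mul_dvd_mul_iff_left (pow_ne_zero _ hp0), 
        show a + p * s - c = p * (s - t) by rw [hc]; ring]
      exact ⟨hcop.dvd_of_dvd_mul_right, fun h => h.mul_right _⟩
    constructor
    · rintro ⟨hx, hxa⟩
      rw [eq_comm, ZMod.intCast_eq_intCast_iff_dvd_sub] at hxa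
      obtain ⟨s, hs⟩ := hxa
      obtain rfl : x = a + p * s := by linarith
      push_cast at hx
      obtain ⟨q, hq⟩ := (key s).1 hx
      have hpe : (0 : ℤ) < (p : ℤ) ^ e := pow_pos (by exact_mod_cast hp.pos) _
      refine ⟨(q % p ^ e).toNat, ?_, ?_⟩
      · zify
        rw [Int.toNat_of_nonneg (Int.emod_nonneg _ hpe.ne')]
        exact Int.emod_lt_of_pos _ hpe
      · rw [Int.toNat_of_nonneg (Int.emod_nonneg _ hpe.ne'), ZMod.intCast_eq_intCast_iff_dvd_sub]
        refine ⟨q / p ^ e, ?_⟩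
        push_cast
        have := Int.emod_add_mul_ediv q (p ^ e)
        linear_combination hq - (p : ℤ) ^ (i + 1) * this
    · rintro ⟨j, -, hj⟩
      rw [ZMod.intCast_eq_intCast_iff_dvd_sub] at hj
      obtain ⟨q, hq⟩ := hj
      push_cast at hq
      obtain rfl : x = a + p * (t + p ^ i * j + p ^ (e + i) * q) := by
        rw [hc] at hq
        linear_combination hq
      refine ⟨?_, by simp⟩
      push_cast
      refine (key _).2 ⟨j + p ^ e * q, ?_⟩
      rw [hc]; ring
  rw [himg, Finset.card_image_of_injOn, Finset.card_range]
  intro j hj l hl hjl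
  simp only [Finset.coe_range, Set.mem_Iio] at hj hl
  have := (ZMod.intCast_eq_intCast_iff_dvd_sub _ _ _).1 hjl
  rw [show c + (p : ℤ) ^ (i + 1) * l - (c + p ^ (i + 1) * j) = p ^ (i + 1) * ((l : ℤ) - j) by ring,
    show e + 1 + i = (i + 1) + e by ring, pow_add] at this
  push_cast at this
  rw [mul_dvd_mul_iff_left (pow_ne_zero _ hp0)] at this
  have h3 : j ≡ l [MOD p ^ e] := (Nat.modEq_iff_dvd).2 (by exact_mod_cast this)
  exact Nat.ModEq.eq_of_lt_of_lt h3 hj hl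

end RootsInClass

/-! ### Powers congruent to 1 in ℤ[√d] -/

namespace Zsqrtd

variable {d : ℤ} {p : ℕ}

theorem natCast_dvd (n : ℕ) (z : ℤ√d) : (n : ℤ√d) ∣ z ↔ (n : ℤ) ∣ z.re ∧ (n : ℤ) ∣ z.im := by
  rw [← intCast_dvd, Int.cast_natCast]

theorem natCast_dvd_star {n : ℕ} {z : ℤ√d} (h : (n : ℤ√d) ∣ z) : (n : ℤ√d) ∣ star z := by
  rw [natCast_dvd] at h ⊢
  exact ⟨h.1, by simpa using h.2⟩

/-- ℤ[√d]/p is reduced for p ∤ 2d: the trace and norm of z vanish modulo p, which forces both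
coordinates to vanish. -/
theorem prime_dvd_of_dvd_pow (hp : p.Prime) (hp2 : p ≠ 2) (hd : ¬ (p : ℤ) ∣ d) {z : ℤ√d}
    (h : (p : ℤ√d) ∣ z ^ p) : (p : ℤ√d) ∣ z := by
  have hpZ := Nat.prime_iff_prime_int.1 hp
  have hs : (p : ℤ√d) ∣ star z ^ p := by
    rw [← star_pow]; exact natCast_dvd_star h
  have hre : (p : ℤ) ∣ z.re := by
    obtain ⟨r, hr⟩ := exists_add_pow_prime_eq hp z (star z)
    have h1 : z + star z = ((2 * z.re : ℤ) : ℤ√d) := by ext <;> simp [two_mul]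
    have h2 : (p : ℤ√d) ∣ (z + star z) ^ p := by
      rw [hr, mul_assoc, mul_assoc]
      exact dvd_add (dvd_add h hs) (dvd_mul_right _ _)
    rw [h1, ← Int.cast_pow, ← Int.cast_natCast, intCast_dvd_intCast] at h2
    refine (hpZ.dvd_or_dvd (hpZ.dvd_of_dvd_pow h2)).resolve_left fun h => hp2 ?_
    exact (Nat.prime_dvd_prime_iff_eq hp Nat.prime_two).1 (by exact_mod_cast h)
  have hnorm : (p : ℤ) ∣ z.norm := by
    refine hpZ.dvd_of_dvd_pow (n := p) ?_
    rw [← intCast_dvd_intCast (d := d), Int.cast_pow, norm_eq_mul_conj, mul_pow, Int.cast_natCast]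
    exact h.mul_right _
  rw [norm_def, mul_assoc, dvd_sub_right (hre.mul_right _)] at hnorm
  have him := (hpZ.dvd_or_dvd hnorm).resolve_left hd
  exact (natCast_dvd _ _).2 ⟨hre, (hpZ.dvd_or_dvd him).elim id id⟩

theorem prime_dvd_sub_one_of_pow (hp : p.Prime) (hp2 : p ≠ 2) (hd : ¬ (p : ℤ) ∣ d) {z : ℤ√d}
    (r : ℕ) (h : (p : ℤ√d) ∣ z ^ p ^ r - 1) : (p : ℤ√d) ∣ z - 1 := by
  induction r with
  | zero => simpa using h
  | succ r ih =>
    refine ih (prime_dvd_of_dvd_pow hp hp2 hd ?_)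
    obtain ⟨c, hc⟩ := exists_add_pow_prime_eq hp (z ^ p ^ r - 1) 1
    rw [sub_add_cancel, ← pow_mul, ← pow_succ, one_pow] at hc
    have : (z ^ p ^ r - 1) ^ p = (z ^ p ^ (r + 1) - 1) - p * ((z ^ p ^ r - 1) * c) := by
      rw [hc]; ring
    rw [this]
    exact dvd_sub h (dvd_mul_right _ _)

/-- Reducedness excludes p-torsion among the units modulo p, so z^(l/p^r) ≡ 1 modulo p already.
Raising to the power p^r then gains r factors of p. -/
theorem pow_dvd_pow_sub_one (hp : p.Prime) (hp2 : p ≠ 2) (hd : ¬ (p : ℤ) ∣ d) {z : ℤ√d}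
    {r l : ℕ} (hl : p ^ r ∣ l) (h : (p : ℤ√d) ∣ z ^ l - 1) : (p : ℤ√d) ^ (r + 1) ∣ z ^ l - 1 := by
  obtain ⟨q, rfl⟩ := hl
  rw [mul_comm, pow_mul] at h ⊢
  have := dvd_sub_pow_of_dvd_sub (prime_dvd_sub_one_of_pow hp hp2 hd r h) r
  rwa [one_pow] at this

end Zsqrtd

/-! ### Chebyshev values as powers of a unit of norm 1 -/

namespace Polynomial.Chebyshev

open Zsqrtd

theorem mk_pow_eq_mk_T_U (x : ℤ) (m : ℕ) :
    (⟨x, 1⟩ : ℤ√(x ^ 2 - 1)) ^ m = ⟨(T ℤ m).eval x, (U ℤ (m - 1)).eval x⟩ := by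
  induction m with
  | zero => ext <;> simp
  | succ m ih =>
    have h1 := congrArg (eval x) (T_eq_X_mul_T_sub_pol_U ℤ ((m : ℤ) - 1))
    have h2 := congrArg (eval x) (U_eq_X_mul_U_add_T ℤ ((m : ℤ) - 1))
    rw [show (m : ℤ) - 1 + 2 = m + 1 by ring] at h1
    rw [show (m : ℤ) - 1 + 1 = m by ring] at h1 h2
    simp only [eval_sub, eval_add, eval_mul, eval_X, eval_one, eval_pow] at h1 h2
    rw [pow_succ _ m, ih]
    ext
    · simp only [Zsqrtd.re_mul, Nat.cast_add, Nat.cast_one, h1]; ring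
    · simp only [Zsqrtd.im_mul, Nat.cast_add, Nat.cast_one, add_sub_cancel_right, h2]; ring

theorem mk_mul_star (x : ℤ) : (⟨x, 1⟩ : ℤ√(x ^ 2 - 1)) * star ⟨x, 1⟩ = 1 := by
  ext
  · simp; ring
  · simp

theorem T_sq_sub_mul_U_sq (x : ℤ) (m : ℕ) :
    (T ℤ m).eval x ^ 2 - (x ^ 2 - 1) * (U ℤ (m - 1)).eval x ^ 2 = 1 := by
  have h := congrArg Zsqrtd.re (congrArg (· ^ m) (mk_mul_star x))
  simp only [mul_pow, ← star_pow, mk_pow_eq_mk_T_U, one_pow] at h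
  simp at h
  linear_combination h

variable {p : ℕ} {x : ℤ} {m : ℕ}

/-- The Pell identity with T_m(x) ≡ x gives (x²-1)(U²-1) ≡ 0 modulo p. -/
theorem exists_sign_of_dvd (hp : p.Prime) (hx : ¬ (p : ℤ) ∣ x ^ 2 - 1)
    (hT : (p : ℤ) ∣ (T ℤ m).eval x - x) :
    ∃ ε : ℤ, (ε = 1 ∨ ε = -1) ∧ (p : ℤ) ∣ (U ℤ (m - 1)).eval x - ε := by
  have hpZ := Nat.prime_iff_prime_int.1 hp
  have h := T_sq_sub_mul_U_sq x m
  have h1 : (p : ℤ) ∣ (x ^ 2 - 1) * (((U ℤ (m - 1)).eval x - 1) * ((U ℤ (m - 1)).eval x - -1)) := by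
    obtain ⟨c, hc⟩ := hT
    exact ⟨c * ((T ℤ m).eval x + x), by linear_combination ((T ℤ m).eval x + x) * hc - h⟩
  rcases hpZ.dvd_or_dvd ((hpZ.dvd_or_dvd h1).resolve_left hx) with h2 | h2
  · exact ⟨1, .inl rfl, h2⟩
  · exact ⟨-1, .inr rfl, h2⟩

theorem pow_dvd_of_dvd_sub_sign (hp : p.Prime) (hp2 : p ≠ 2) (hx : ¬ (p : ℤ) ∣ x ^ 2 - 1)
    (hm : 1 ≤ m) (hT : (p : ℤ) ∣ (T ℤ m).eval x - x) {ε : ℤ} (hε : ε = 1 ∨ ε = -1)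
    (hU : (p : ℤ) ∣ (U ℤ (m - 1)).eval x - ε) {r : ℕ} (hr : (p : ℤ) ^ r ∣ m - ε) :
    (p : ℤ) ^ (r + 1) ∣ (T ℤ m).eval x - x ∧ (p : ℤ) ^ (r + 1) ∣ (U ℤ (m - 1)).eval x - ε := by
  set α : ℤ√(x ^ 2 - 1) := ⟨x, 1⟩ with hα
  have hunit : α * star α = 1 := mk_mul_star x
  -- The element ⟨x, ε⟩ is α^ε, so α^m - α^ε = α^ε(α^(m-ε) - 1); take l = m - ε and β = α^ε with
  -- inverse γ.
  obtain ⟨l, β, γ, hβ, hl, hmul⟩ : ∃ (l : ℕ) (β γ : ℤ√(x ^ 2 - 1)), γ * β = 1 ∧ p ^ r ∣ l ∧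
      α ^ m - ⟨x, ε⟩ = β * (α ^ l - 1) := by
    rcases hε with rfl | rfl
    · refine ⟨m - 1, α, star α, by rw [mul_comm, hunit], ?_, ?_⟩
      · zify [hm]; exact hr
      · obtain ⟨m, rfl⟩ := Nat.exists_eq_add_of_le' hm
        rw [Nat.add_sub_cancel, ← hα]; ring
    · refine ⟨m + 1, star α, α, hunit, ?_, ?_⟩
      · zify; simpa using hr
      · have : (⟨x, -1⟩ : ℤ√(x ^ 2 - 1)) = star α := by simp [hα]
        rw [this]
        linear_combination -α ^ m * hunit
  have hsub : α ^ m - ⟨x, ε⟩ = ⟨(T ℤ m).eval x - x, (U ℤ (m - 1)).eval x - ε⟩ := by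
    rw [hα, mk_pow_eq_mk_T_U]
    ext <;> simp
  have h1 : (p : ℤ√(x ^ 2 - 1)) ∣ α ^ l - 1 := by
    have : (p : ℤ√(x ^ 2 - 1)) ∣ γ * (α ^ m - ⟨x, ε⟩) := by
      rw [hsub]; exact ((natCast_dvd _ _).2 ⟨hT, hU⟩).mul_left _
    rwa [hmul, ← mul_assoc, hβ, one_mul] at this
  have h2 := (pow_dvd_pow_sub_one hp hp2 hx hl h1).mul_left β
  rw [← hmul, hsub, ← Nat.cast_pow, natCast_dvd] at h2
  exact_mod_cast h2

/-- Squaring m removes the sign: α^m ≡ α^ε implies α^(m²) ≡ α. -/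
theorem dvd_T_sq_sub_and_dvd_U_sq_sub_one (hp : p.Prime) (hx : ¬ (p : ℤ) ∣ x ^ 2 - 1)
    (hT : (p : ℤ) ∣ (T ℤ m).eval x - x) :
    (p : ℤ) ∣ (T ℤ (m ^ 2 : ℕ)).eval x - x ∧ (p : ℤ) ∣ (U ℤ ((m ^ 2 : ℕ) - 1)).eval x - 1 := by
  obtain ⟨ε, hε, hU⟩ := exists_sign_of_dvd hp hx hT
  set α : ℤ√(x ^ 2 - 1) := ⟨x, 1⟩ with hα
  have h1 : (p : ℤ√(x ^ 2 - 1)) ∣ α ^ m - ⟨x, ε⟩ := by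
    rw [hα, mk_pow_eq_mk_T_U, natCast_dvd]
    simpa using ⟨hT, hU⟩
  suffices h : (p : ℤ√(x ^ 2 - 1)) ∣ α ^ m ^ 2 - α by
    rw [hα, mk_pow_eq_mk_T_U, natCast_dvd] at h
    simpa using h
  rw [pow_two m, pow_mul α]
  rcases hε with rfl | rfl
  · have h2 := h1.trans (sub_dvd_pow_sub_pow _ _ m)
    rw [← hα] at h1 h2
    simpa using dvd_add h2 h1
  · have h2 := h1.trans (sub_dvd_pow_sub_pow _ _ m)
    have : (⟨x, -1⟩ : ℤ√(x ^ 2 - 1)) = star α := by simp [hα]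
    rw [this] at h1 h2
    have h3 := natCast_dvd_star h1
    rw [star_sub, star_star, star_pow] at h3
    simpa using dvd_add h2 h3

end Polynomial.Chebyshev

/-! ### Higher derivatives from the Chebyshev differential equation -/

namespace Polynomial.Chebyshev

theorem dvd_iterate_derivative_T {N x : ℤ} {m : ℕ} (hx : IsCoprime N (1 - x ^ 2))
    (hm : N ∣ (m : ℤ) ^ 2 - 1) (h0 : N ∣ (T ℤ m).eval x - x)
    (h1 : N ∣ (derivative (T ℤ m)).eval x - 1) (j : ℕ) :
    N ∣ (derivative^[j + 2] (T ℤ m)).eval x := by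
  have hbase : N ∣ (derivative^[2] (T ℤ m)).eval x := by
    refine hx.dvd_of_dvd_mul_left ?_
    have h := one_sub_X_sq_mul_iterate_derivative_T_eval (m : ℤ) 0 x
    rw [zero_add] at h
    rw [h]
    convert dvd_sub (dvd_sub (h1.mul_left x) (h0.mul_left (m ^ 2))) (hm.mul_left x) using 1
    simp only [Function.iterate_succ, Function.iterate_zero, Function.comp_apply, id_eq,
      Nat.cast_zero, Int.cast_natCast]
    ring
  induction j using Nat.twoStepInduction with
  | zero => exact hbase
  | one =>
    refine hx.dvd_of_dvd_mul_left ?_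
    rw [one_sub_X_sq_mul_iterate_derivative_T_eval]
    refine dvd_sub (hbase.mul_left _) (Dvd.dvd.mul_right ?_ _)
    simpa using hm
  | more j h h' =>
    refine hx.dvd_of_dvd_mul_left ?_
    rw [one_sub_X_sq_mul_iterate_derivative_T_eval]
    exact dvd_sub (h'.mul_left _) (h.mul_left _)

theorem eval_derivative_T_of_sq_eq_one {x : ℤ} (hx : x ^ 2 = 1) {m : ℕ}
    (hT : (T ℤ m).eval x = x) : (derivative (T ℤ m)).eval x = m ^ 2 := by
  have h := one_sub_X_sq_mul_iterate_derivative_T_eval (m : ℤ) 0 x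
  simp only [Function.iterate_succ, Function.iterate_zero, Function.comp_apply, id_eq,
    Nat.cast_zero, hx, hT] at h
  have h2 : x * (eval x (derivative (T ℤ m)) - m ^ 2) = 0 := by linear_combination -h
  have hx0 : x ≠ 0 := by rintro rfl; norm_num at hx
  exact sub_eq_zero.1 ((mul_eq_zero.1 h2).resolve_left hx0)

-- At x = ±1 the second-order recurrence degenerates to first order, with leading factors 2k+1 that
-- (2j)! absorbs; its k = 1 step supplies the factor m² - 1.
open Nat in
theorem dvd_factorial_mul_iterate_derivative_T {N x : ℤ} {m : ℕ} (hx : x ^ 2 = 1)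
    (hm : N ∣ (m : ℤ) ^ 2 - 1) {j : ℕ} (hj : 2 ≤ j) :
    N ∣ ((2 * j)! : ℕ) * (derivative^[j] (T ℤ m)).eval x := by
  have hrec : ∀ k : ℕ, (2 * k + 1) * (derivative^[k + 1] (T ℤ m)).eval x =
      x * ((m ^ 2 - k ^ 2) * (derivative^[k] (T ℤ m)).eval x) := by
    intro k
    have h := one_sub_X_sq_mul_iterate_derivative_T_eval (m : ℤ) k x
    rw [hx, sub_self, zero_mul] at h
    linear_combination (-x) * h - (2 * k + 1) * (derivative^[k + 1] (T ℤ m)).eval x * hx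
  induction j, hj using Nat.le_induction with
  | base =>
    have h := hrec 1
    norm_num [Nat.factorial] at h ⊢
    have : 24 * eval x (derivative (derivative (T ℤ m))) =
      (m ^ 2 - 1) * (8 * x * eval x (derivative (T ℤ m))) := by linear_combination 8 * h
    rw [this]
    exact hm.mul_right _
  | succ j hj ih =>
    rw [show 2 * (j + 1) = 2 * j + 1 + 1 by ring, Nat.factorial_succ, Nat.factorial_succ]
    have : (((2 * j + 1 + 1) * ((2 * j + 1) * (2 * j)!) : ℕ) : ℤ) *
        (derivative^[j + 1] (T ℤ m)).eval x =
        ((2 * j)! : ℕ) * (derivative^[j] (T ℤ m)).eval x * ((2 * j + 2) * (x * (m ^ 2 - j ^ 2))) := by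
      push_cast
      linear_combination (2 * j + 2) * ((2 * j)! : ℤ) * hrec j
    rw [this]
    exact ih.mul_right _

end Polynomial.Chebyshev

-- Legendre's bound; equality holds at p = 5, j = 5, and the inequality fails for p = 3, j = 2.
open Nat in
theorem padicValNat_factorial_mul_factorial_le {p : ℕ} (hp : p.Prime) (hp3 : 3 < p) {j : ℕ}
    (hj : 2 ≤ j) : padicValNat p ((2 * j)! * j !) ≤ j - 2 := by
  have := Fact.mk hp
  have hp5 : 5 ≤ p := by
    rcases Nat.lt_or_ge p 5 with h | h
    · obtain rfl : p = 4 := by omega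
      exact absurd hp (by norm_num)
    · exact h
  rw [padicValNat.mul (Nat.factorial_ne_zero _) (Nat.factorial_ne_zero _)]
  have h1 := sub_one_mul_padicValNat_factorial_lt_of_ne_zero (p := p) (n := 2 * j) (by omega)
  have h2 := sub_one_mul_padicValNat_factorial_lt_of_ne_zero (p := p) (n := j) (by omega)
  have h3 := Nat.mul_le_mul_right (padicValNat p (2 * j)!) (show 4 ≤ p - 1 by omega)
  have h4 := Nat.mul_le_mul_right (padicValNat p j !) (show 4 ≤ p - 1 by omega)
  omega

-- The factor p^j pays for the denominators (2j)! and j! and still leaves p².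
open Nat in
theorem pow_dvd_pow_mul_hasseDeriv {p : ℕ} (hp : p.Prime) (hp3 : 3 < p) {g : ℤ[X]} {a : ℤ}
    {e j : ℕ} (hj : 2 ≤ j)
    (h : (p : ℤ) ^ e ∣ ((2 * j)! : ℕ) * (derivative^[j] g).eval a) :
    (p : ℤ) ^ (e + 2) ∣ p ^ j * (hasseDeriv j g).eval a := by
  have hv := padicValNat_factorial_mul_factorial_le hp hp3 hj
  have := Fact.mk hp
  set N := (2 * j)! * j ! with hN
  have hN0 : N ≠ 0 := mul_ne_zero (Nat.factorial_ne_zero _) (Nat.factorial_ne_zero _)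
  obtain ⟨v, N', hN', hNv⟩ := Nat.exists_eq_pow_mul_and_not_dvd hN0 p hp.ne_one
  have hvv : padicValNat p N = v := by
    rw [hNv, padicValNat.mul (pow_ne_zero _ hp.ne_zero) (by rintro rfl; simp at hN'),
      padicValNat.prime_pow, padicValNat.eq_zero_of_not_dvd hN', add_zero]
  have hcop : IsCoprime ((p : ℤ) ^ e) (N' : ℤ) := by
    refine IsCoprime.pow_left (Nat.isCoprime_iff_coprime.2 ?_)
    exact (Nat.Prime.coprime_iff_not_dvd hp).2 hN'
  rw [← factorial_smul_hasseDeriv] at h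
  have h1 : (p : ℤ) ^ e ∣ N' * (p ^ v * (hasseDeriv j g).eval a) := by
    have : ((2 * j)! : ℤ) * ((j ! : ℕ) * (hasseDeriv j g).eval a) =
        N' * (p ^ v * (hasseDeriv j g).eval a) := by
      have hN2 : (((2 * j)! : ℕ) : ℤ) * ((j ! : ℕ) : ℤ) = p ^ v * N' := by
        exact_mod_cast hN.symm.trans hNv
      linear_combination (hasseDeriv j g).eval a * hN2
    rw [← this]
    simpa using h
  have h2 := hcop.dvd_of_dvd_mul_left h1
  obtain ⟨i, rfl⟩ : ∃ i, j = v + i + 2 := ⟨j - v - 2, by omega⟩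
  rw [show v + i + 2 = i + v + 2 by ring, pow_add, pow_add _ (i + v), mul_right_comm]
  refine mul_dvd_mul_right ?_ _
  rw [pow_add, mul_assoc]
  rw [show i + v + 2 = v + i + 2 by ring]
  exact h2.mul_left _

/-! ### Fixed points of T_m in a residue class modulo p -/

namespace Polynomial.Chebyshev

variable {p : ℕ} {x : ℤ} {m : ℕ}

theorem iterate_derivative_T_sub_X {j : ℕ} (hj : 2 ≤ j) :
    derivative^[j] (T ℤ m - X) = derivative^[j] (T ℤ m) := by
  obtain ⟨j, rfl⟩ := Nat.exists_eq_add_of_le' hj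
  simp [Function.iterate_add_apply]

theorem pow_dvd_pow_mul_hasseDeriv_of_sq_eq_one (hp : p.Prime) (hp3 : 3 < p) (hx : x ^ 2 = 1)
    {e : ℕ} (hm : (p : ℤ) ^ e ∣ (m : ℤ) ^ 2 - 1) {j : ℕ} (hj : 2 ≤ j) :
    (p : ℤ) ^ (e + 2) ∣ p ^ j * (hasseDeriv j (T ℤ m - X)).eval x := by
  refine pow_dvd_pow_mul_hasseDeriv hp hp3 hj ?_
  rw [iterate_derivative_T_sub_X hj]
  exact dvd_factorial_mul_iterate_derivative_T hx hm hj

theorem T_eval_of_sq_eq_one (hm : Odd m) (hx : x ^ 2 = 1) : (T ℤ m).eval x = x := by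
  rcases (Commute.all x 1 |>.sq_eq_sq_iff_eq_or_eq_neg).1 (hx.trans (one_pow 2).symm) with rfl | rfl
  · simp
  · rw [T_eval_neg_one, Int.negOnePow_odd _ (by exact_mod_cast hm)]; rfl

theorem exists_sq_eq_one_dvd_sub (hp : p.Prime) (hx : (p : ℤ) ∣ x ^ 2 - 1) :
    ∃ a : ℤ, a ^ 2 = 1 ∧ (p : ℤ) ∣ x - a := by
  have : (p : ℤ) ∣ (x - 1) * (x - -1) := by convert hx using 1; ring
  rcases (Nat.prime_iff_prime_int.1 hp).dvd_or_dvd this with h | h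
  · exact ⟨1, by norm_num, h⟩
  · exact ⟨-1, by norm_num, h⟩

/-- Every residue class modulo `p` that is fixed by `T_m` has a representative at which the Taylor
expansion of `T_m - X` is dominated by its linear term. -/
theorem exists_taylor_dominated (hp : p.Prime) (hp3 : 3 < p) (hm : Odd m) (hm1 : 1 < m)
    (hT : (p : ℤ) ∣ (T ℤ m).eval x - x) :
    ∃ (a : ℤ) (e : ℕ) (u : ℤ), (p : ℤ) ∣ x - a ∧ (p : ℤ) ^ e ∣ (m : ℤ) ^ 2 - 1 ∧
      (p : ℤ) ^ (e + 1) ∣ (T ℤ m - X).eval a ∧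
      (derivative (T ℤ m - X)).eval a = p ^ e * u ∧ ¬ (p : ℤ) ∣ u ∧
      ∀ j, 2 ≤ j → (p : ℤ) ^ (e + 2) ∣ p ^ j * (hasseDeriv j (T ℤ m - X)).eval a := by
  have hpZ := Nat.prime_iff_prime_int.1 hp
  have hm1' : (1 : ℤ) < m := by exact_mod_cast hm1
  by_cases hx : (p : ℤ) ∣ x ^ 2 - 1
  -- In the class of ±1 the representative is ±1 itself: it is fixed exactly, with derivative m², so
  -- e is the valuation of m² - 1.
  · obtain ⟨a, ha, hxa⟩ := exists_sq_eq_one_dvd_sub hp hx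
    have hTa := T_eval_of_sq_eq_one hm ha
    have hm0 : (m : ℤ) ^ 2 - 1 ≠ 0 := by nlinarith
    obtain ⟨u, hu, hpu⟩ := (Int.finiteMultiplicity_iff.2 ⟨by simpa using hp.ne_one, hm0⟩ :
      FiniteMultiplicity (p : ℤ) _).exists_eq_pow_mul_and_not_dvd
    set e := multiplicity (p : ℤ) ((m : ℤ) ^ 2 - 1)
    refine ⟨a, e, u, hxa, ⟨u, hu⟩, by simp [hTa], ?_, hpu, fun j hj =>
      pow_dvd_pow_mul_hasseDeriv_of_sq_eq_one hp hp3 ha ⟨u, hu⟩ hj⟩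
    rw [derivative_sub, derivative_X, eval_sub, eval_one, eval_derivative_T_of_sq_eq_one ha hTa, hu]
  · obtain ⟨ε, hε, hU⟩ := exists_sign_of_dvd hp hx hT
    have hε2 : ε ^ 2 = 1 := by rcases hε with rfl | rfl <;> norm_num
    have hm0 : (m : ℤ) - ε ≠ 0 := by rcases hε with rfl | rfl <;> linarith
    obtain ⟨c, hc, hpc⟩ := (Int.finiteMultiplicity_iff.2 ⟨by simpa using hp.ne_one, hm0⟩ :
      FiniteMultiplicity (p : ℤ) _).exists_eq_pow_mul_and_not_dvd
    -- Elsewhere a = x. Since U_{m-1}(x) ≡ ε modulo p^(e+1), the derivative m·U_{m-1}(x) - 1 equals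
    -- ε(m-ε) up to a multiple of p^(e+1).
    set e := multiplicity (p : ℤ) ((m : ℤ) - ε)
    obtain ⟨hTe, y, hy⟩ := pow_dvd_of_dvd_sub_sign hp (by omega) hx hm.pos hT hε hU ⟨c, hc⟩
    have hm2 : (p : ℤ) ^ e ∣ (m : ℤ) ^ 2 - 1 :=
      ⟨c * (m + ε), by linear_combination (m + ε) * hc + hε2⟩
    have hder : (derivative (T ℤ m)).eval x - 1 = p ^ e * (ε * c + p * (m * y)) := by
      rw [T_derivative_eq_U, eval_mul, eval_intCast, Int.cast_natCast]
      linear_combination (m : ℤ) * hy + ε * hc + hε2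
    refine ⟨x, e, ε * c + p * (m * y), by simp, hm2, by simpa using hTe, ?_, ?_, fun j hj => ?_⟩
    · rw [derivative_sub, derivative_X, eval_sub, eval_one, hder]
    · rw [Int.dvd_add_left (dvd_mul_right _ _)]
      intro h
      refine hpc ((hpZ.dvd_or_dvd h).resolve_left fun h1 => hpZ.not_dvd_one ?_)
      rw [← hε2]
      exact dvd_pow h1 two_ne_zero
    · refine pow_dvd_pow_mul_hasseDeriv hp hp3 hj ?_
      rw [iterate_derivative_T_sub_X hj]
      obtain ⟨j, rfl⟩ := Nat.exists_eq_add_of_le' hj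
      refine (dvd_iterate_derivative_T ?_ hm2 ?_ ⟨_, hder⟩ j).mul_left _
      · rw [← neg_sub, IsCoprime.neg_right_iff]
        exact IsCoprime.pow_left ((hpZ.coprime_iff_not_dvd).2 hx)
      · exact (pow_dvd_pow _ (Nat.le_succ e)).trans hTe

/-- If `m ≡ 1` modulo `p ^ r`, and `T_m` fixes `x` modulo `p` without reflecting its residue class,
then `T_m` fixes `x` modulo `p ^ (r + 1)`. -/
theorem pow_dvd_T_eval_sub (hp : p.Prime) (hp3 : 3 < p) (hm : Odd m)
    (hT : (p : ℤ) ∣ (T ℤ m).eval x - x)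
    (hU : ¬ (p : ℤ) ∣ x ^ 2 - 1 → (p : ℤ) ∣ (U ℤ (m - 1)).eval x - 1) {r : ℕ}
    (hr : (p : ℤ) ^ r ∣ m - 1) : (p : ℤ) ^ (r + 1) ∣ (T ℤ m).eval x - x := by
  by_cases hx : (p : ℤ) ∣ x ^ 2 - 1
  · obtain ⟨a, ha, s, hs⟩ := exists_sq_eq_one_dvd_sub hp hx
    have hTa := T_eval_of_sq_eq_one hm ha
    obtain rfl : x = a + p * s := by linarith
    have hr2 : (p : ℤ) ^ r ∣ (m : ℤ) ^ 2 - 1 := by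
      rw [show (m : ℤ) ^ 2 - 1 = (m - 1) * (m + 1) by ring]
      exact hr.mul_right _
    obtain ⟨P, hP⟩ := (T ℤ m - X).exists_eval_add_mul_eq a p ((p : ℤ) ^ (r + 2)) fun j hj =>
      pow_dvd_pow_mul_hasseDeriv_of_sq_eq_one hp hp3 ha hr2 hj
    have h := hP s
    simp only [eval_sub, eval_X, derivative_sub, derivative_X, eval_one, hTa, sub_self,
      eval_derivative_T_of_sq_eq_one ha hTa] at h
    obtain ⟨c, hc⟩ := hr2
    rw [h, hc]
    exact ⟨c * s + p * P.eval s, by ring⟩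
  · exact (pow_dvd_of_dvd_sub_sign hp (by omega) hx hm.pos hT (.inl rfl) (hU hx) hr).1

end Polynomial.Chebyshev

/-! ### Stability of the number of fixed points -/

namespace Polynomial.Chebyshev

theorem iterate_eval_T {R : Type*} [CommRing R] (n : ℕ) (L : ℕ) (x : R) :
    (fun y : R => (T R n).eval y)^[L] x = (T R (n ^ L : ℕ)).eval x := by
  induction L with
  | zero => simp
  | succ L ih =>
    rw [Function.iterate_succ_apply', ih, pow_succ', Nat.cast_mul, T_mul, eval_comp]

theorem iterate_eval_T_intCast_eq_iff (n L N : ℕ) (x : ℤ) :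
    (fun y : ZMod N => (T (ZMod N) n).eval y)^[L] (x : ZMod N) = x ↔
      (N : ℤ) ∣ (T ℤ (n ^ L : ℕ)).eval x - x := by
  rw [iterate_eval_T, ← map_T (Int.castRingHom (ZMod N)), eval_intCast_map, eq_intCast, eq_comm,
    ZMod.intCast_eq_intCast_iff_dvd_sub]
  rfl

open Classical in
/-- The number of fixed points of `T_m` modulo `p ^ k` in a given residue class modulo `p` does
not depend on `k`, once `k` exceeds the exponent of `p` in `m ^ 2 - 1`. -/
theorem exists_card_fixed_residue_class {p m v : ℕ} [Fact p.Prime] (hp3 : 3 < p) (hm : Odd m)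
    (hm1 : 1 < m) (hv : ∀ t : ℕ, (p : ℤ) ^ t ∣ (m : ℤ) ^ 2 - 1 → t ≤ v) (b : ZMod p) :
    ∃ c : ℕ, ∀ (k : ℕ) (hk : k ≠ 0), v < k → (Finset.univ.filter fun x : ZMod (p ^ k) =>
      ((T ℤ m - X).map (Int.castRingHom (ZMod (p ^ k)))).eval x = 0 ∧
      ZMod.castHom (dvd_pow_self p hk) (ZMod p) x = b).card = c := by
  have hp : p.Prime := Fact.out
  obtain ⟨x, rfl⟩ := ZMod.intCast_surjective b
  by_cases hT : (p : ℤ) ∣ (T ℤ m).eval x - x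
  · obtain ⟨a, e, u, hxa, he, h0, h1, hu, h2⟩ := exists_taylor_dominated hp hp3 hm hm1 hT
    refine ⟨p ^ e, fun k hk hvk => ?_⟩
    rw [← (ZMod.intCast_eq_intCast_iff_dvd_sub a x p).2 hxa]
    have := hv e he
    exact card_roots_residue_class hp h0 h1 hu h2 (by omega)
  · refine ⟨0, fun k hk _ => ?_⟩
    rw [Finset.card_eq_zero, Finset.filter_eq_empty_iff]
    rintro y - ⟨hy, hyx⟩
    obtain ⟨y, rfl⟩ := ZMod.intCast_surjective y
    rw [eval_intCast_map, eq_intCast, ZMod.intCast_zmod_eq_zero_iff_dvd] at hy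
    rw [map_intCast, eq_comm, ZMod.intCast_eq_intCast_iff_dvd_sub] at hyx
    refine hT ?_
    have h1 : (p : ℤ) ∣ (T ℤ m - X).eval y := by
      refine dvd_trans ?_ hy
      exact_mod_cast dvd_pow_self p hk
    have h2 := hyx.trans ((T ℤ m - X).sub_dvd_eval_sub y x)
    simpa using (dvd_sub_right h1).1 h2

theorem card_fixed_eq {p m v : ℕ} [Fact p.Prime] (hp3 : 3 < p) (hm : Odd m)
    (hm1 : 1 < m) (hv : ∀ t : ℕ, (p : ℤ) ^ t ∣ (m : ℤ) ^ 2 - 1 → t ≤ v) {k l : ℕ} (hk : v < k)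
    (hl : v < l) :
    (Finset.univ.filter fun x : ZMod (p ^ k) => (T (ZMod (p ^ k)) m).eval x = x).card =
      (Finset.univ.filter fun x : ZMod (p ^ l) => (T (ZMod (p ^ l)) m).eval x = x).card := by
  classical
  choose c hc using exists_card_fixed_residue_class hp3 hm hm1 hv
  have key : ∀ k, v < k →
      (Finset.univ.filter fun x : ZMod (p ^ k) => (T (ZMod (p ^ k)) m).eval x = x).card =
        ∑ b, c b := by
    intro k hk
    have hk0 : k ≠ 0 := by omega
    rw [Finset.card_eq_sum_card_fiberwise (t := Finset.univ)
      (f := ZMod.castHom (dvd_pow_self p hk0) (ZMod p)) fun _ _ => Finset.mem_univ _]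
    refine Finset.sum_congr rfl fun b _ => ?_
    rw [← hc b k hk0 hk]
    congr 1
    ext x
    rw [Finset.mem_filter, Finset.mem_filter, Finset.mem_filter]
    simp [map_T, sub_eq_zero]
  rw [key k hk, key l hl]

end Polynomial.Chebyshev

/-! ### Valuation of n^(2d) - 1 -/

section Order

variable {p n w : ℕ}

theorem one_lt_pow_two_mul_orderOf [Fact p.Prime] (hn : 1 < n) (hnp : ¬ p ∣ n) :
    1 < n ^ (2 * orderOf ((n : ZMod p) ^ 2)) := by
  have h0 : (n : ZMod p) ^ 2 ≠ 0 := by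
    rw [Ne, pow_eq_zero_iff two_ne_zero, ZMod.natCast_eq_zero_iff]; exact hnp
  refine Nat.one_lt_pow (mul_ne_zero two_ne_zero ?_) hn
  intro h
  have := ZMod.orderOf_dvd_card_sub_one h0
  rw [h, zero_dvd_iff] at this
  have := (Fact.out : p.Prime).two_le
  omega

theorem dvd_pow_two_mul_orderOf_sub_one (p n : ℕ) (hn : 1 ≤ n) :
    p ∣ n ^ (2 * orderOf ((n : ZMod p) ^ 2)) - 1 := by
  rw [← ZMod.natCast_eq_zero_iff, Nat.cast_sub (Nat.one_le_pow _ _ hn)]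
  simp [pow_mul, pow_orderOf_eq_one]

theorem isGreatest_padicValNat [Fact p.Prime] (hn : 1 < n) (hnp : ¬ p ∣ n) :
    IsGreatest {t : ℕ | n ^ (2 * orderOf ((n : ZMod p) ^ 2)) ≡ 1 [MOD p ^ t]}
      (padicValNat p (n ^ (2 * orderOf ((n : ZMod p) ^ 2)) - 1)) := by
  have h1 := one_lt_pow_two_mul_orderOf hn hnp
  have hiff : ∀ t, n ^ (2 * orderOf ((n : ZMod p) ^ 2)) ≡ 1 [MOD p ^ t] ↔
      t ≤ padicValNat p (n ^ (2 * orderOf ((n : ZMod p) ^ 2)) - 1) := fun t => by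
    rw [Nat.ModEq.comm, Nat.modEq_iff_dvd' h1.le, padicValNat_dvd_iff_le (by omega)]
  exact ⟨(hiff _).2 le_rfl, fun t ht => (hiff t).1 ht⟩

theorem pow_dvd_pow_orderOf_mul_sub_one_iff [Fact p.Prime] (hp2 : p ≠ 2) (hn : 1 < n)
    (hnp : ¬ p ∣ n) {c : ℕ} (hc : c ≠ 0) (t : ℕ) :
    p ^ t ∣ n ^ (2 * (orderOf ((n : ZMod p) ^ 2) * c)) - 1 ↔
      t ≤ padicValNat p (n ^ (2 * orderOf ((n : ZMod p) ^ 2)) - 1) + padicValNat p c := by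
  have h1 := one_lt_pow_two_mul_orderOf hn hnp
  have hodd : Odd p := (Fact.out : p.Prime).odd_of_ne_two hp2
  have h := padicValNat.pow_sub_pow (p := p) hodd h1
    (dvd_pow_two_mul_orderOf_sub_one p n hn.le)
    (fun h => hnp ((Fact.out : p.Prime).dvd_of_dvd_pow h)) hc
  rw [one_pow, ← pow_mul] at h
  rw [← mul_assoc, ← h, padicValNat_dvd_iff_le]
  have := Nat.one_lt_pow hc h1
  rw [← pow_mul] at this
  omega

/-- For t > 0 the order of n² divides d, and lifting the exponent applies to the quotient. -/
theorem le_of_pow_dvd_pow_sub_one [Fact p.Prime] (hp2 : p ≠ 2) (hn : 1 < n) (hnp : ¬ p ∣ n)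
    {d t : ℕ} (hd : d ≠ 0) (h : (p : ℤ) ^ t ∣ ((n ^ d : ℕ) : ℤ) ^ 2 - 1) :
    t ≤ padicValNat p (n ^ (2 * orderOf ((n : ZMod p) ^ 2)) - 1) + padicValNat p d := by
  have h' : p ^ t ∣ n ^ (2 * d) - 1 := by
    zify [Nat.one_le_pow (2 * d) n (by omega)]
    rw [mul_comm, pow_mul]
    exact_mod_cast h
  rcases Nat.eq_zero_or_pos t with rfl | ht
  · exact Nat.zero_le _
  have hord : orderOf ((n : ZMod p) ^ 2) ∣ d := by
    rw [orderOf_dvd_iff_pow_eq_one]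
    have := (ZMod.natCast_eq_zero_iff _ p).2 ((dvd_pow_self p ht.ne').trans h')
    rw [Nat.cast_sub (Nat.one_le_pow _ _ (by omega)), sub_eq_zero] at this
    simpa [pow_mul] using this
  obtain ⟨c, rfl⟩ := hord
  have hc : c ≠ 0 := right_ne_zero_of_mul hd
  refine ((pow_dvd_pow_orderOf_mul_sub_one_iff hp2 hn hnp hc t).1 h').trans ?_
  rw [padicValNat.mul (left_ne_zero_of_mul hd) hc]
  omega

end Order

/-! ### Powers of p dividing a cycle length -/

section Periods

variable {p n : ℕ}

/-- The orbit of a periodic point other than y never meets y. -/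
theorem Function.minimalPeriod_lt_card_of_isFixedPt {V : Type*} [Fintype V]
    {f : V → V} {y : V} (hy : Function.IsFixedPt f y) (h1 : 2 < Fintype.card V) (x : V) :
    Function.minimalPeriod f x < Fintype.card V := by
  classical
  by_cases hx : x ∈ Function.periodicPts f
  · by_cases hxy : x = y
    · rw [hxy, Function.minimalPeriod_eq_one_iff_isFixedPt.2 hy]; omega
    · have hsub : (Finset.range (Function.minimalPeriod f x)).image (fun i => f^[i] x) ⊆
          Finset.univ.erase y := by
        intro z hz
        obtain ⟨i, -, rfl⟩ := Finset.mem_image.1 hz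
        refine Finset.mem_erase.2 ⟨fun h => hxy ?_, Finset.mem_univ _⟩
        have h4 := Function.periodicOrbit_apply_iterate_eq hx i
        have h5 : x ∈ Function.periodicOrbit f (f^[i] x) := by
          rw [h4]; exact Function.self_mem_periodicOrbit hx
        rw [h, Function.mem_periodicOrbit_iff
          (Function.mk_mem_periodicPts one_pos hy)] at h5
        obtain ⟨j, hj⟩ := h5
        rw [← hj]
        exact Function.iterate_fixed hy j
      have := Finset.card_le_card hsub
      rw [Finset.card_image_of_injOn, Finset.card_range,
        Finset.card_erase_of_mem (Finset.mem_univ _), Finset.card_univ] at this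
      · omega
      · rw [Finset.coe_range]
        exact Function.iterate_injOn_Iio_minimalPeriod
  · rw [Function.minimalPeriod_eq_zero_of_notMem_periodicPts hx]; omega

open Polynomial.Chebyshev

theorem padicValNat_minimalPeriod_le [Fact p.Prime] (hp3 : 3 < p) (hodd : Odd n) (hn : 1 < n)
    (hnp : ¬ p ∣ n) {i : ℕ} (x : ZMod (p ^
      (padicValNat p (n ^ (2 * orderOf ((n : ZMod p) ^ 2)) - 1) + 1 + i))) :
    padicValNat p (Function.minimalPeriod (chebyshevMap n p _) x) ≤ i := by
  have hp : p.Prime := Fact.out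
  obtain ⟨x, rfl⟩ := ZMod.intCast_surjective x
  set w := padicValNat p (n ^ (2 * orderOf ((n : ZMod p) ^ 2)) - 1) with hw
  set L := Function.minimalPeriod (chebyshevMap n p (w + 1 + i)) (x : ZMod (p ^ (w + 1 + i)))
    with hL
  rcases Nat.eq_zero_or_pos L with hL0 | hLpos
  · rw [hL0]; simp
  set f : ZMod p → ZMod p := fun y => (T (ZMod p) n).eval y with hf
  have hfL : f^[L] (x : ZMod p) = x := by
    rw [iterate_eval_T_intCast_eq_iff]
    have h : (chebyshevMap n p (w + 1 + i))^[L] (x : ZMod (p ^ (w + 1 + i))) = x :=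
      Function.isPeriodicPt_minimalPeriod _ _
    have h2 := (iterate_eval_T_intCast_eq_iff n L (p ^ (w + 1 + i)) x).1 h
    refine dvd_trans ?_ h2
    exact_mod_cast dvd_pow_self p (by omega)
  set L₁ := Function.minimalPeriod f (x : ZMod p) with hL₁
  have hL₁pos : 0 < L₁ := Function.IsPeriodicPt.minimalPeriod_pos hLpos hfL
  have hL₁lt : L₁ < p := by
    have h1 : Function.IsFixedPt f 1 := T_eval_one (ZMod p) n
    have := Function.minimalPeriod_lt_card_of_isFixedPt h1 (by rw [ZMod.card]; omega)
      (x : ZMod p)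
    rwa [ZMod.card] at this
  set d := orderOf ((n : ZMod p) ^ 2) with hd
  have hn0 : (n : ZMod p) ^ 2 ≠ 0 := by
    rw [Ne, pow_eq_zero_iff two_ne_zero, ZMod.natCast_eq_zero_iff]; exact hnp
  have hdvd : d ∣ p - 1 := ZMod.orderOf_dvd_card_sub_one hn0
  have hdpos : 0 < d := Nat.pos_of_dvd_of_pos hdvd (by omega)
  have hdlt : d < p := by have := Nat.le_of_dvd (by omega) hdvd; omega
  -- L₁ makes T_{n^E} fix x modulo p; d and p^i make n^(2E) ≡ 1 modulo p^(w+i). Passing to the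
  -- square of n^E then discards a possible sign -1.
  set E := d * (L₁ * p ^ i) with hE
  have hTM : (p : ℤ) ∣ (T ℤ (n ^ E : ℕ)).eval x - x := by
    rw [← iterate_eval_T_intCast_eq_iff]
    exact Function.isPeriodicPt_iff_minimalPeriod_dvd.2 ⟨d * p ^ i, by rw [hE]; ring⟩
  have hLc : L₁ * p ^ i ≠ 0 := mul_ne_zero hL₁pos.ne' (pow_ne_zero _ hp.ne_zero)
  have hr : (p : ℤ) ^ (w + i) ∣ (((n ^ E) ^ 2 : ℕ) : ℤ) - 1 := by
    have h : p ^ (w + i) ∣ n ^ (2 * E) - 1 :=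
      (pow_dvd_pow_orderOf_mul_sub_one_iff (by omega) hn hnp hLc (w + i)).2 (by
        rw [padicValNat.mul hL₁pos.ne' (pow_ne_zero _ hp.ne_zero), padicValNat.prime_pow]; omega)
    have h1 : 1 ≤ n ^ (2 * E) := Nat.one_le_pow _ _ (by omega)
    rw [← pow_mul, mul_comm E 2]
    rwa [← Int.natCast_dvd_natCast, Nat.cast_sub h1, Nat.cast_one, Nat.cast_pow p] at h
  have hT2 : (p : ℤ) ^ (w + i + 1) ∣ (T ℤ ((n ^ E) ^ 2 : ℕ)).eval x - x := by
    refine pow_dvd_T_eval_sub hp hp3 (hodd.pow.pow) ?_ ?_ hr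
    · by_cases hx : (p : ℤ) ∣ x ^ 2 - 1
      · obtain ⟨a, ha, hxa⟩ := exists_sq_eq_one_dvd_sub hp hx
        have h := hxa.trans ((T ℤ ((n ^ E) ^ 2 : ℕ)).sub_dvd_eval_sub x a)
        rw [T_eval_of_sq_eq_one hodd.pow.pow ha] at h
        simpa using dvd_sub h hxa
      · exact (dvd_T_sq_sub_and_dvd_U_sq_sub_one hp hx hTM).1
    · exact fun hx => (dvd_T_sq_sub_and_dvd_U_sq_sub_one hp hx hTM).2
  have hper : L ∣ E * 2 := by
    refine Function.IsPeriodicPt.minimalPeriod_dvd ?_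
    refine (iterate_eval_T_intCast_eq_iff n (E * 2) (p ^ (w + 1 + i)) x).2 ?_
    rw [pow_mul, show w + 1 + i = w + i + 1 by ring]
    exact_mod_cast hT2
  -- The factors d, L₁ and 2 of 2E are all below p, so only p^i contributes to its valuation.
  have hcop : ∀ q, 0 < q → q < p → padicValNat p q = 0 := fun q h1 h2 =>
    padicValNat.eq_zero_of_not_dvd (Nat.not_dvd_of_pos_of_lt h1 h2)
  have hE0 : E * 2 ≠ 0 := mul_ne_zero (mul_ne_zero hdpos.ne' hLc) two_ne_zero
  have hle : padicValNat p L ≤ padicValNat p (E * 2) :=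
    (padicValNat_dvd_iff_le hE0).1 (pow_padicValNat_dvd.trans hper)
  rwa [padicValNat.mul (mul_ne_zero hdpos.ne' hLc) two_ne_zero, padicValNat.mul hdpos.ne' hLc,
    padicValNat.mul hL₁pos.ne' (pow_ne_zero _ hp.ne_zero), padicValNat.prime_pow,
    hcop d hdpos hdlt, hcop _ hL₁pos hL₁lt, hcop 2 two_pos (by omega), zero_add, zero_add,
    add_zero] at hle

/-- Every d ∣ L has v_p(d) ≤ v_p(L), so one threshold serves the fixed-point counts of all these
iterates. -/
theorem numChebyshevCycles_eq [Fact p.Prime] (hp3 : 3 < p) (hodd : Odd n) (hn : 1 < n)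
    (hnp : ¬ p ∣ n) {L k l : ℕ} (hL : 0 < L)
    (hk : padicValNat p (n ^ (2 * orderOf ((n : ZMod p) ^ 2)) - 1) + padicValNat p L < k)
    (hl : padicValNat p (n ^ (2 * orderOf ((n : ZMod p) ^ 2)) - 1) + padicValNat p L < l) :
    numChebyshevCycles n p L k = numChebyshevCycles n p L l := by
  refine numDirectedCycles_eq_of_card_isPeriodicPt_eq _ _ hL fun d hd => ?_
  have hd0 : d ≠ 0 := (Nat.pos_of_dvd_of_pos hd hL).ne'
  have h := card_fixed_eq hp3 (hodd.pow (n := d)) (Nat.one_lt_pow hd0 hn) (fun t ht =>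
    (le_of_pow_dvd_pow_sub_one (by omega) hn hnp hd0 ht).trans (Nat.add_le_add_left
      ((padicValNat_dvd_iff_le hL.ne').1 (pow_padicValNat_dvd.trans hd)) _)) hk hl
  simp only [← iterate_eval_T] at h
  exact h

end Periods

/-! ### Assembly of the three claims -/

theorem theorem3 (p : ℕ) (hp : p.Prime) (hp3 : 3 < p) (n : ℕ) (hn : 1 < n)
    (hnp : Nat.gcd n p = 1) (hnp2 : Nat.gcd n (p ^ 2 - 1) = 1) :
    ∃ w ks : ℕ,
      IsGreatest {t : ℕ | n ^ (2 * orderOf ((n : ZMod p) ^ 2)) ≡ 1 [MOD p ^ t]} w ∧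
      ks = w + 1 ∧
      -- a cycle length that occurs modulo `p ^ ks`
      (∀ Tc : ℕ, 0 < Tc → numChebyshevCycles n p Tc ks ≠ 0 →
        ∀ k, ks < k → numChebyshevCycles n p Tc k = numChebyshevCycles n p Tc ks) ∧
      -- a cycle length that occurs modulo some higher power `p ^ k₀`
      (∀ Tc : ℕ, 0 < Tc → ∀ k₀, ks < k₀ → numChebyshevCycles n p Tc k₀ ≠ 0 →
        ∀ k, k₀ < k → numChebyshevCycles n p Tc k = numChebyshevCycles n p Tc k₀) ∧
      -- every length, occurring or not; if `p` does not divide it, the threshold is `ks`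
      (∀ Tc : ℕ, 0 < Tc → ∀ k, ks + padicValNat p Tc < k →
        numChebyshevCycles n p Tc k = numChebyshevCycles n p Tc (ks + padicValNat p Tc)) := by
  have := Fact.mk hp
  have hpn : ¬ p ∣ n := (hp.coprime_iff_not_dvd).1 (Nat.Coprime.symm hnp)
  -- Since p² - 1 is even, coprimality to it makes n odd; oddness is what makes every T_m with m a
  -- power of n fix -1.
  have hodd : Odd n := by
    rw [← Nat.not_even_iff_odd, even_iff_two_dvd]
    intro h2
    have hp2 : 2 ∣ p ^ 2 - 1 := by
      have : Odd (p ^ 2) := (hp.odd_of_ne_two (by omega)).pow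
      exact even_iff_two_dvd.1 (Nat.Odd.sub_odd this odd_one)
    have := Nat.dvd_gcd h2 hp2
    rw [hnp2] at this
    omega
  set w := padicValNat p (n ^ (2 * orderOf ((n : ZMod p) ^ 2)) - 1) with hw
  have hocc : ∀ Tc i, numChebyshevCycles n p Tc (w + 1 + i) ≠ 0 → padicValNat p Tc ≤ i := by
    intro Tc i h
    obtain ⟨x, hx⟩ := exists_minimalPeriod_eq_of_numDirectedCycles_ne_zero h
    rw [← hx]
    exact padicValNat_minimalPeriod_le hp3 hodd hn hpn x
  refine ⟨w, w + 1, isGreatest_padicValNat hn hpn, rfl, ?_, ?_, ?_⟩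
  · intro Tc hTc h k hk
    have := hocc Tc 0 h
    exact numChebyshevCycles_eq hp3 hodd hn hpn hTc (by omega) (by omega)
  · intro Tc hTc k₀ hk₀ h k hk
    obtain ⟨i, rfl⟩ := Nat.exists_eq_add_of_lt hk₀
    -- Here k₀ = (w + 1) + i + 1, so the excess over the threshold is i + 1.
    have := hocc Tc (i + 1) h
    exact numChebyshevCycles_eq hp3 hodd hn hpn hTc (by omega) (by omega)
  · intro Tc hTc k hk
    exact numChebyshevCycles_eq hp3 hodd hn hpn hTc (by omega) (by omega)
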